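/- Let $a,b,c,\rho_0,\rho_1$ be complex-valued functions of a complex frequency $\omega$, let $\alpha,\beta\in\mathbb{C}$, and let $\omega$ be a frequency at which $c(\omega)\notin\{0,-1,-2,\dots\}$ and $c(\omega)-a(\omega)-b(\omega)\notin\mathbb{Z}$. For $0<z<1$ put (with $a,b,c,\rho_0,\rho_1$ evaluated at $\omega$) $$R_{\rm in}(z;\omega)=z^{\rho_0}(1-z)^{\rho_1}\,{}_2F_1(a,b;c;z),$$ $$R_{\rm slow}(z;\omega)=z^{\rho_0}(1-z)^{\rho_1}\,{}_2F_1(a,b;a+b-c+1;1-z),$$ $$R_{\rm fast}(z;\omega)=z^{\rho_0}(1-z)^{\rho_1+c-a-b}\,{}_2F_1(c-a,c-b;c-a-b+1;1-z),$$ $$C_{\rm slow}(\omega)=\frac{\Gamma(c)\Gamma(c-a-b)}{\Gamma(c-a)\Gamma(c-b)},\qquad C_{\rm fast}(\omega)=\frac{\Gamma(c)\Gamma(a+b-c)}{\Gamma(a)\Gamma(b)},$$ where $1/\Gamma$ is read as $0$ at the poles of $\Gamma$, and $$F_{\alpha,\beta}(\omega)=\alpha\,C_{\rm slow}(\omega)+\beta\,C_{\rm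 fast}(\omega),\qquad R_{\mathcal B}(z;\omega)=\beta R_{\rm slow}(z;\omega)-\alpha R_{\rm fast}(z;\omega).$$ Write $W[u,v](z;\omega)=u\,\partial_z v-v\,\partial_z u$. Then $R_{\rm in}$, $R_{\rm slow}$, $R_{\rm fast}$ (hence $R_{\mathcal B}$) are differentiable in $z$ on $(0,1)$, and for every $z\in(0,1)$ $$W[R_{\rm in},R_{\mathcal B}](z;\omega)=-F_{\alpha,\beta}(\omega)\,W[R_{\rm slow},R_{\rm fast}](z;\omega).$$ -/

import Mathlib

noncomputable section

namespace HypergeometricSpectral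

/-- The frequency-dependent parameters of a radial problem in the hypergeometric spectral class:
the parameters `a(ω), b(ω), c(ω)` of the Gauss equation, the horizon exponent `ρ₀(ω)` and the
boundary exponent `ρ₁(ω)`. This is plain data, with no condition imposed. -/
structure Params where
  a : ℂ → ℂ
  b : ℂ → ℂ
  c : ℂ → ℂ
  ρ₀ : ℂ → ℂ
  ρ₁ : ℂ → ℂ

/-- The ingoing solution `z^ρ₀ (1-z)^ρ₁ ₂F₁(a, b; c; z)`, as a function of the real radial
variable `z` (used on `0 < z < 1`, where the powers have positive real bases and the
hypergeometric series converges). -/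
def Rin (p : Params) (ω : ℂ) (z : ℝ) : ℂ :=
  (z : ℂ) ^ p.ρ₀ ω * (1 - (z : ℂ)) ^ p.ρ₁ ω * ₂F₁ (p.a ω) (p.b ω) (p.c ω) (z : ℂ)

/-- The slow branch at the boundary,
`z^ρ₀ (1-z)^ρ₁ ₂F₁(a, b; a+b-c+1; 1-z)`. -/
def Rslow (p : Params) (ω : ℂ) (z : ℝ) : ℂ :=
  (z : ℂ) ^ p.ρ₀ ω * (1 - (z : ℂ)) ^ p.ρ₁ ω *
    ₂F₁ (p.a ω) (p.b ω) (p.a ω + p.b ω - p.c ω + 1) (1 - (z : ℂ))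

/-- The fast branch at the boundary,
`z^ρ₀ (1-z)^(ρ₁+c-a-b) ₂F₁(c-a, c-b; c-a-b+1; 1-z)`. -/
def Rfast (p : Params) (ω : ℂ) (z : ℝ) : ℂ :=
  (z : ℂ) ^ p.ρ₀ ω * (1 - (z : ℂ)) ^ (p.ρ₁ ω + p.c ω - p.a ω - p.b ω) *
    ₂F₁ (p.c ω - p.a ω) (p.c ω - p.b ω) (p.c ω - p.a ω - p.b ω + 1) (1 - (z : ℂ))

/-- The connection coefficient `Γ(c)Γ(c-a-b) / (Γ(c-a)Γ(c-b))`. At a pole of a Gamma function in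
the denominator the quotient is `0` here, which agrees with `1/Γ` being entire and zero there. -/
def Cslow (p : Params) (ω : ℂ) : ℂ :=
  Complex.Gamma (p.c ω) * Complex.Gamma (p.c ω - p.a ω - p.b ω) /
    (Complex.Gamma (p.c ω - p.a ω) * Complex.Gamma (p.c ω - p.b ω))

/-- The connection coefficient `Γ(c)Γ(a+b-c) / (Γ(a)Γ(b))`, with the same convention at the poles
of the denominator. -/
def Cfast (p : Params) (ω : ℂ) : ℂ :=
  Complex.Gamma (p.c ω) * Complex.Gamma (p.a ω + p.b ω - p.c ω) /
    (Complex.Gamma (p.a ω) * Complex.Gamma (p.b ω))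

/-- The quantization function `F_{α,β}(ω) = α C_slow(ω) + β C_fast(ω)`. -/
def quantizationF (p : Params) (α β ω : ℂ) : ℂ :=
  α * Cslow p ω + β * Cfast p ω

/-- The solution adapted to the outer boundary condition, `R_B = β R_slow - α R_fast`. -/
def RB (p : Params) (α β ω : ℂ) (z : ℝ) : ℂ :=
  β * Rslow p ω z - α * Rfast p ω z

/-- The Wronskian `W[u, v](z) = u(z) v'(z) - v(z) u'(z)` in the real variable `z`. -/
def wronskian (u v : ℝ → ℂ) (z : ℝ) : ℂ :=
  u z * deriv v z - v z * deriv u z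

end HypergeometricSpectral

end

/-! Everything reduces to Gauss's connection formula `connection_formula`, which gives `Rin = Cslow
* Rslow + Cfast * Rfast` on `(0,1)`. The Wronskian is bilinear and alternating, so pairing this with
`β * Rslow - α * Rfast` leaves `-(α * Cslow + β * Cfast)` times `W[Rslow, Rfast]`. Existence of
connection constants `A, B` is linear algebra: by Abel's identity the weighted Wronskians of
solutions are constant on the lens where both local expansions converge, and that of slow and fast
is `-(c - a - b) ≠ 0`. The value of `B` comes from the behaviour at `1`. If `Re (c - a - b) < 0`,
the fast solution dominates, and an Abelian theorem together with Gauss's limit for `Γ` gives its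
coefficient. Differentiation raises `a, b, c` by one and lowers `Re (c - a - b)` by one, so
induction removes the sign condition. Euler's transformation exchanges slow and fast, so the formula
for `B` also yields `A`. -/

namespace GaussHypergeometric

open Filter Topology Metric

/-! ### Power series on the unit disc and the Gauss operator -/

/-- The function `f` is the sum of the power series with coefficients `t` on the open unit disc. -/
def HasPowerSeries (t : ℕ → ℂ) (f : ℂ → ℂ) : Prop :=
  ∀ x : ℂ, ‖x‖ < 1 → HasSum (fun n => t n * x ^ n) (f x)

namespace HasPowerSeries

variable {t u : ℕ → ℂ} {f g : ℂ → ℂ}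

theorem add (hf : HasPowerSeries t f) (hg : HasPowerSeries u g) :
    HasPowerSeries (fun n => t n + u n) (fun x => f x + g x) := fun x hx => by
  simpa only [add_mul] using (hf x hx).add (hg x hx)

theorem sub (hf : HasPowerSeries t f) (hg : HasPowerSeries u g) :
    HasPowerSeries (fun n => t n - u n) (fun x => f x - g x) := fun x hx => by
  simpa only [sub_mul] using (hf x hx).sub (hg x hx)

theorem const_mul (k : ℂ) (hf : HasPowerSeries t f) :
    HasPowerSeries (fun n => k * t n) (fun x => k * f x) := fun x hx => by
  simpa only [mul_assoc] using (hf x hx).mul_left k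

theorem id_mul (h0 : t 0 = 0) (hf : HasPowerSeries (fun n => t (n + 1)) f) :
    HasPowerSeries t (fun x => x * f x) := fun x hx => by
  rw [← hasSum_nat_add_iff' 1]
  have h := (hf x hx).mul_left x
  simp only [Finset.sum_range_one, h0, zero_mul, sub_zero]
  convert! h using 2 with n
  ring

theorem congr_coeff (hf : HasPowerSeries t f) (h : ∀ n, u n = t n) : HasPowerSeries u f := by
  rwa [show u = t from funext h]

theorem congr_fun (hf : HasPowerSeries t f) (h : ∀ x, ‖x‖ < 1 → g x = f x) :
    HasPowerSeries t g := fun x hx => by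
  rw [h x hx]
  exact hf x hx

theorem hasFPowerSeriesOnBall (hf : HasPowerSeries t f) :
    HasFPowerSeriesOnBall f (FormalMultilinearSeries.ofScalars ℂ t) 0 1 where
  r_le := by
    -- Summability at each real `r < 1` makes the terms tend to zero, which bounds the radius below
    -- by `r`.
    refine ENNReal.le_of_forall_nnreal_lt fun r hr => ?_
    have hr' : ‖((r : ℝ) : ℂ)‖ < 1 := by
      simpa using (by exact_mod_cast hr : (r : ℝ) < 1)
    have h := (hf _ hr').summable.tendsto_atTop_zero.norm
    refine FormalMultilinearSeries.le_radius_of_tendsto _ (l := ‖(0 : ℂ)‖) (h.congr fun n => ?_)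
    simp
  r_pos := one_pos
  hasSum := fun {y} hy => by
    have hy' : ‖y‖ < 1 := by
      simpa [← ofReal_norm] using hy
    simpa [mul_comm] using hf y hy'

theorem differentiableOn (hf : HasPowerSeries t f) : DifferentiableOn ℂ f (ball 0 1) := by
  have h := hf.hasFPowerSeriesOnBall.differentiableOn
  rwa [← ENNReal.ofReal_one, Metric.eball_ofReal] at h

theorem iteratedDeriv_eq (hf : HasPowerSeries t f) (n : ℕ) :
    iteratedDeriv n f 0 = n.factorial * t n := by
  have h := hf.hasFPowerSeriesOnBall.factorial_smul 1 n
  rw [iteratedDeriv_eq_iteratedFDeriv, ← h]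
  simp

theorem unique (hf : HasPowerSeries t f) (hg : HasPowerSeries u g)
    (h : ∀ x, ‖x‖ < 1 → f x = g x) (n : ℕ) : t n = u n := by
  have h1 := hf.iteratedDeriv_eq n
  rw [(hg.congr_fun h).iteratedDeriv_eq n] at h1
  exact (mul_left_cancel₀ (by exact_mod_cast n.factorial_ne_zero) h1).symm

theorem _root_.DifferentiableOn.hasPowerSeries (hf : DifferentiableOn ℂ f (ball 0 1)) :
    HasPowerSeries (fun n => iteratedDeriv n f 0 / n.factorial) f := fun x hx => by
  have h := Complex.hasSum_taylorSeries_on_ball hf (z := x) (by simpa using hx)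
  simp only [sub_zero, smul_eq_mul] at h
  convert! h using 2
  ring

/-- A holomorphic function on the disc is its Taylor series, so the coefficients can be read off
from iterated derivatives at `0`, without termwise differentiation. -/
protected theorem deriv (hf : HasPowerSeries t f) :
    HasPowerSeries (fun n => (n + 1) * t (n + 1)) (deriv f) := by
  refine (hf.differentiableOn.deriv isOpen_ball).hasPowerSeries.congr_coeff fun n => ?_
  rw [← iteratedDeriv_succ', hf.iteratedDeriv_eq, Nat.factorial_succ]
  have : (n.factorial : ℂ) ≠ 0 := by exact_mod_cast n.factorial_ne_zero
  push_cast
  field_simp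

/-- The Gauss operator acts on power series by a two-term recursion. -/
theorem gaussOperator (a b c : ℂ) (hf : HasPowerSeries t f) :
    HasPowerSeries (fun n => (n + 1) * (n + c) * t (n + 1) - (n + a) * (n + b) * t n)
      (fun x => x * (1 - x) * deriv (deriv f) x + (c - (a + b + 1) * x) * deriv f x
        - a * b * f x) := by
  have h1 : HasPowerSeries (fun n => n * t n) (fun x => x * deriv f x) :=
    id_mul (by simp) (hf.deriv.congr_coeff fun n => by push_cast; ring)
  have h2 : HasPowerSeries (fun n => n * ((n + 1) * t (n + 1))) (fun x => x * deriv (deriv f) x) :=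
    id_mul (by simp) (hf.deriv.deriv.congr_coeff fun n => by push_cast; ring)
  have h3 : HasPowerSeries (fun n => n * (n - 1) * t n) (fun x => x * (x * deriv (deriv f) x)) :=
    id_mul (by simp) (h2.congr_coeff fun n => by push_cast; ring)
  refine ((((h2.sub h3).add (hf.deriv.const_mul c)).sub (h1.const_mul (a + b + 1))).sub
    (hf.const_mul (a * b))).congr_coeff (fun n => ?_) |>.congr_fun fun x _ => ?_ <;> ring

end HasPowerSeries

/-! ### The hypergeometric series and its contiguity relations -/

/-- The coefficients of the Gauss hypergeometric series. -/
noncomputable def coeff (a b c : ℂ) (n : ℕ) : ℂ := ordinaryHypergeometricCoefficient a b c n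

theorem coeff_succ (a b c : ℂ) (n : ℕ) (hc : c + n ≠ 0) :
    (n + 1) * (n + c) * coeff a b c (n + 1) = (n + a) * (n + b) * coeff a b c n := by
  have hn : (n : ℂ) + 1 ≠ 0 := by exact_mod_cast n.succ_ne_zero
  simp only [coeff, ordinaryHypergeometricCoefficient, ascPochhammer_succ_eval, Nat.factorial_succ]
  push_cast
  rw [mul_inv, mul_inv, add_comm (n : ℂ) c]
  field_simp
  ring

theorem ascPochhammer_eval_succ_left (a : ℂ) (n : ℕ) :
    (ascPochhammer ℂ (n + 1)).eval a = a * (ascPochhammer ℂ n).eval (a + 1) := by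
  simp [ascPochhammer_succ_left]

theorem ascPochhammer_eval_ne_zero {s : ℂ} (hs : ∀ n : ℕ, s ≠ -(n : ℂ)) (n : ℕ) :
    (ascPochhammer ℂ n).eval s ≠ 0 := by
  rw [Ne, ascPochhammer_eval_eq_zero_iff]
  rintro ⟨k, -, hk⟩
  exact hs k (by rw [hk]; ring)

theorem add_one_ne_neg_natCast {c : ℂ} (hc : ∀ n : ℕ, c ≠ -(n : ℂ)) (n : ℕ) :
    c + 1 ≠ -(n : ℂ) :=
  fun h => hc (n + 1) (by push_cast; linear_combination h)

theorem coeff_succ_shift (a b c : ℂ) (n : ℕ) :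
    (n + 1) * coeff a b c (n + 1) = a * b / c * coeff (a + 1) (b + 1) (c + 1) n := by
  have hn : (n : ℂ) + 1 ≠ 0 := by exact_mod_cast n.succ_ne_zero
  simp only [coeff, ordinaryHypergeometricCoefficient, ascPochhammer_eval_succ_left,
    Nat.factorial_succ]
  push_cast
  rw [mul_inv, mul_inv]
  field_simp

/-- Convergence is inherited from the regularized series `₂F₁ / Γ(c)`, rescaled by `Γ(c) ≠ 0`. -/
theorem hasPowerSeries_hypergeometric (a b : ℂ) {c : ℂ} (hc : ∀ n : ℕ, c ≠ -(n : ℂ)) :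
    HasPowerSeries (coeff a b c) (₂F₁ a b c) := fun x hx => by
  have hrad := Complex.radius_regularizedGaussHGFunSeries_ge_one a b c
  have hx' : x ∈ Metric.eball (0 : ℂ) (a.regularizedGaussHGFunSeries b c).radius := by
    refine Metric.eball_subset_eball hrad ?_
    simpa [← ofReal_norm] using hx
  have h := (FormalMultilinearSeries.hasSum _ hx').mul_left (Complex.Gamma c)
  have hG : Complex.Gamma c ≠ 0 := Complex.Gamma_ne_zero hc
  have h2 := Complex.ordinaryHypergeometric_div_Gamma_eq (a := a) (b := b) (z := x) hc
  rw [div_eq_iff hG, mul_comm] at h2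
  rw [h2]
  convert! h using 2 with n
  rw [FormalMultilinearSeries.apply_eq_prod_smul_coeff,
    ← Complex.Gamma_inv_mul_ordinaryHypergeometricSeries_eq hc, ordinaryHypergeometricSeries,
    FormalMultilinearSeries.coeff_ofScalars, coeff]
  simp only [Finset.prod_const, Finset.card_univ, Fintype.card_fin, smul_eq_mul]
  field_simp

theorem deriv_hypergeometric (a b : ℂ) {c x : ℂ} (hc : ∀ n : ℕ, c ≠ -(n : ℂ)) (hx : ‖x‖ < 1) :
    deriv (₂F₁ a b c) x = a * b / c * ₂F₁ (a + 1) (b + 1) (c + 1) x :=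
  ((hasPowerSeries_hypergeometric a b hc).deriv x hx).unique
    (((hasPowerSeries_hypergeometric (a + 1) (b + 1) (add_one_ne_neg_natCast hc)).const_mul
      (a * b / c)).congr_coeff (fun n => coeff_succ_shift a b c n) x hx)

/-- Coefficientwise this is `(n + c) / (c + 1)ₙ = c / (c)ₙ`. It puts the derivative of the fast
solution back into closed form. -/
theorem hypergeometric_lowering (a b : ℂ) {c x : ℂ} (hc : ∀ n : ℕ, c ≠ -(n : ℂ)) (hx : ‖x‖ < 1) :
    x * deriv (₂F₁ a b (c + 1)) x + c * ₂F₁ a b (c + 1) x = c * ₂F₁ a b c x := by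
  have hc' := add_one_ne_neg_natCast hc
  have hF := hasPowerSeries_hypergeometric a b hc'
  have h1 : HasPowerSeries (fun n => n * coeff a b (c + 1) n)
      (fun x => x * deriv (₂F₁ a b (c + 1)) x) :=
    .id_mul (by simp) (hF.deriv.congr_coeff fun n => by push_cast; ring)
  refine ((h1.add (hF.const_mul c)) x hx).unique
    (((hasPowerSeries_hypergeometric a b hc).const_mul c).congr_coeff (fun n => ?_) x hx)
  have h2 : (ascPochhammer ℂ n).eval c * (c + n) = c * (ascPochhammer ℂ n).eval (c + 1) := by
    rw [← ascPochhammer_succ_eval, ascPochhammer_eval_succ_left]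
  have h3 := ascPochhammer_eval_ne_zero hc n
  have h4 := ascPochhammer_eval_ne_zero hc' n
  simp only [coeff, ordinaryHypergeometricCoefficient]
  field_simp
  linear_combination ((n.factorial : ℂ)⁻¹ * (ascPochhammer ℂ n).eval a *
    (ascPochhammer ℂ n).eval b) * h2

/-! ### Solutions of the Gauss equation and Euler's transformation -/

/-- The function `f` solves the Gauss equation with parameters `a, b, c` on the open set `U`. -/
structure IsGaussSolution (a b c : ℂ) (U : Set ℂ) (f : ℂ → ℂ) : Prop where
  differentiableOn : DifferentiableOn ℂ f U
  equation : ∀ z ∈ U, z * (1 - z) * deriv (deriv f) z + (c - (a + b + 1) * z) * deriv f z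
    - a * b * f z = 0

theorem isGaussSolution_hypergeometric (a b : ℂ) {c : ℂ} (hc : ∀ n : ℕ, c ≠ -(n : ℂ)) :
    IsGaussSolution a b c (ball 0 1) (₂F₁ a b c) where
  differentiableOn := (hasPowerSeries_hypergeometric a b hc).differentiableOn
  equation z hz := by
    have h := ((hasPowerSeries_hypergeometric a b hc).gaussOperator a b c) z (by simpa using hz)
    refine h.unique ?_
    convert! hasSum_zero (α := ℂ) (β := ℕ) using 2 with n
    simp only [coeff_succ a b c n fun h => hc n (eq_neg_of_add_eq_zero_left h), sub_self, zero_mul]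

theorem one_sub_mem_slitPlane {z : ℂ} (hz : ‖z‖ < 1) : 1 - z ∈ Complex.slitPlane := by
  simpa [sub_eq_add_neg] using Complex.mem_slitPlane_of_norm_lt_one (z := -z) (by simpa using hz)

theorem hasDerivAt_one_sub_cpow (s : ℂ) {z : ℂ} (hz : 1 - z ∈ Complex.slitPlane) :
    HasDerivAt (fun z : ℂ => (1 - z) ^ s) (-(s * (1 - z) ^ (s - 1))) z := by
  convert! ((hasDerivAt_id z).const_sub 1).cpow_const (c := s) hz using 1
  simp

theorem deriv_one_sub_cpow_mul (s : ℂ) {f : ℂ → ℂ} {z : ℂ} (hz : 1 - z ∈ Complex.slitPlane)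
    (hf : DifferentiableAt ℂ f z) :
    deriv (fun z => (1 - z) ^ s * f z) z =
      (1 - z) ^ s * deriv f z - s * ((1 - z) ^ (s - 1) * f z) := by
  rw [((hasDerivAt_one_sub_cpow s hz).fun_mul hf.hasDerivAt).deriv]
  ring

namespace IsGaussSolution

variable {a b c : ℂ} {U V : Set ℂ} {f g : ℂ → ℂ}

theorem mono (hf : IsGaussSolution a b c U f) (h : V ⊆ U) : IsGaussSolution a b c V f :=
  ⟨hf.differentiableOn.mono h, fun z hz => hf.equation z (h hz)⟩

theorem hasDerivAt (hf : IsGaussSolution a b c U f) (hU : IsOpen U) {z : ℂ} (hz : z ∈ U) :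
    HasDerivAt f (deriv f z) z :=
  (hf.differentiableOn.differentiableAt (hU.mem_nhds hz)).hasDerivAt

theorem hasDerivAt_deriv (hf : IsGaussSolution a b c U f) (hU : IsOpen U) {z : ℂ} (hz : z ∈ U) :
    HasDerivAt (deriv f) (deriv (deriv f) z) z :=
  ((hf.differentiableOn.deriv hU).differentiableAt (hU.mem_nhds hz)).hasDerivAt

theorem reflect (hf : IsGaussSolution a b c U f) (hU : IsOpen U) (hV : ∀ z ∈ V, 1 - z ∈ U) :
    IsGaussSolution a b (a + b + 1 - c) V (fun z => f (1 - z)) where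
  differentiableOn := fun z hz =>
    ((hf.hasDerivAt hU (hV z hz)).differentiableAt.comp z
      ((differentiableAt_const 1).sub differentiableAt_id)).differentiableWithinAt
  equation z hz := by
    have h1 : deriv (fun z => f (1 - z)) = fun z => -deriv f (1 - z) := by
      ext w; exact deriv_comp_const_sub f 1 w
    have h2 : deriv (fun z => -deriv f (1 - z)) z = deriv (deriv f) (1 - z) := by
      rw [deriv.fun_neg, deriv_comp_const_sub, neg_neg]
    rw [h1, h2]
    linear_combination hf.equation _ (hV z hz)

/-- The exponents at `1` for `(c - a, c - b, c)` are `0` and `a + b - c`; the power shifts them to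
`c - a - b` and `0`, those for `(a, b, c)`. -/
theorem one_sub_cpow_mul (hf : IsGaussSolution (c - a) (c - b) c U f) (hU : IsOpen U)
    (hs : ∀ z ∈ U, 1 - z ∈ Complex.slitPlane) :
    IsGaussSolution a b c U (fun z => (1 - z) ^ (c - a - b) * f z) where
  differentiableOn := fun z hz =>
    ((hasDerivAt_one_sub_cpow _ (hs z hz)).mul
      (hf.hasDerivAt hU hz)).differentiableAt.differentiableWithinAt
  equation z hz := by
    have hd : ∀ w ∈ U, deriv (fun z => (1 - z) ^ (c - a - b) * f z) w =
        (1 - w) ^ (c - a - b) * deriv f w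
          - (c - a - b) * ((1 - w) ^ (c - a - b - 1) * f w) := fun w hw =>
      deriv_one_sub_cpow_mul _ (hs w hw) (hf.hasDerivAt hU hw).differentiableAt
    have h2 : deriv (deriv (fun z => (1 - z) ^ (c - a - b) * f z)) z =
        (1 - z) ^ (c - a - b) * deriv (deriv f) z
          - (c - a - b) * ((1 - z) ^ (c - a - b - 1) * deriv f z)
          - (c - a - b) * ((1 - z) ^ (c - a - b - 1) * deriv f z
          - (c - a - b - 1) * ((1 - z) ^ (c - a - b - 1 - 1) * f z)) := by
      have hev : deriv (fun z => (1 - z) ^ (c - a - b) * f z) =ᶠ[𝓝 z] fun w =>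
          (1 - w) ^ (c - a - b) * deriv f w
          - (c - a - b) * ((1 - w) ^ (c - a - b - 1) * f w) := by
        filter_upwards [hU.mem_nhds hz] with w hw using hd w hw
      have hdf := (hf.hasDerivAt hU hz).differentiableAt
      have hddf := (hf.hasDerivAt_deriv hU hz).differentiableAt
      have hp := fun s => (hasDerivAt_one_sub_cpow s (hs z hz)).differentiableAt
      rw [hev.deriv_eq, deriv_fun_sub ((hp _).fun_mul hddf) (((hp _).fun_mul hdf).const_mul _),
        deriv_const_mul_field, deriv_one_sub_cpow_mul _ (hs z hz) hdf,
        deriv_one_sub_cpow_mul _ (hs z hz) hddf]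
    have hz1 : 1 - z ≠ 0 := Complex.slitPlane_ne_zero (hs z hz)
    rw [h2, hd z hz]
    simp only [Complex.cpow_sub _ (1 : ℂ) hz1, Complex.cpow_one]
    have hode := hf.equation z hz
    generalize (1 - z) ^ (c - a - b) = P
    field_simp
    linear_combination P * (1 - z) * hode

/-- A solution which is analytic at the origin is determined by its value there. -/
theorem eqOn_ball (hc : ∀ n : ℕ, c ≠ -(n : ℂ)) (hf : IsGaussSolution a b c (ball 0 1) f)
    (hg : IsGaussSolution a b c (ball 0 1) g) (h0 : f 0 = g 0) : Set.EqOn f g (ball 0 1) := by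
  have key := hf.differentiableOn.hasPowerSeries.sub hg.differentiableOn.hasPowerSeries
  set t : ℕ → ℂ := fun n => iteratedDeriv n f 0 / n.factorial - iteratedDeriv n g 0 / n.factorial
  have hzero : HasPowerSeries (fun _ => 0) (fun _ => 0) := fun x _ => by simp
  -- The difference of the solutions is again a solution; since `n + c ≠ 0`, the recursion
  -- propagates the vanishing of its coefficient of index `0`.
  have hrec : ∀ n : ℕ, (n + 1) * (n + c) * t (n + 1) - (n + a) * (n + b) * t n = 0 := by
    refine (key.gaussOperator a b c).unique hzero fun x hx => ?_
    have hx' : x ∈ ball (0 : ℂ) 1 := by simpa using hx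
    have hd : ∀ w ∈ ball (0 : ℂ) 1, deriv (fun x => f x - g x) w = deriv f w - deriv g w :=
      fun w hw => deriv_fun_sub (hf.hasDerivAt isOpen_ball hw).differentiableAt
        (hg.hasDerivAt isOpen_ball hw).differentiableAt
    have hdd : deriv (deriv (fun x => f x - g x)) x = deriv (deriv f) x - deriv (deriv g) x := by
      have hev : deriv (fun x => f x - g x) =ᶠ[𝓝 x] fun w => deriv f w - deriv g w := by
        filter_upwards [isOpen_ball.mem_nhds hx'] with w hw using hd w hw
      rw [hev.deriv_eq, deriv_fun_sub (hf.hasDerivAt_deriv isOpen_ball hx').differentiableAt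
        (hg.hasDerivAt_deriv isOpen_ball hx').differentiableAt]
    rw [hdd, hd x hx']
    linear_combination hf.equation x hx' - hg.equation x hx'
  have ht : ∀ n, t n = 0 := by
    intro n
    induction n with
    | zero => simp [t, h0]
    | succ n ih =>
      have h := hrec n
      rw [ih, mul_zero, sub_zero, mul_eq_zero, mul_eq_zero] at h
      rcases h with (h | h) | h
      · exact absurd h (by exact_mod_cast n.succ_ne_zero)
      · exact absurd (eq_neg_of_add_eq_zero_right h) (hc n)
      · exact h
  intro x hx
  have h := key x (by simpa using hx)
  simp only [ht, zero_mul] at h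
  exact sub_eq_zero.mp (h.unique hasSum_zero)

end IsGaussSolution

/-- **Euler's transformation** of the hypergeometric function. -/
theorem euler_transformation (a b : ℂ) {c x : ℂ} (hc : ∀ n : ℕ, c ≠ -(n : ℂ)) (hx : ‖x‖ < 1) :
    (1 - x) ^ (c - a - b) * ₂F₁ (c - a) (c - b) c x = ₂F₁ a b c x := by
  refine ((isGaussSolution_hypergeometric (c - a) (c - b) hc).one_sub_cpow_mul isOpen_ball
    fun z hz => one_sub_mem_slitPlane (by simpa using hz)).eqOn_ball hc
    (isGaussSolution_hypergeometric a b hc) (by simp) (by simpa using hx)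

/-! ### Abel's identity and linear dependence -/

/-- The Wronskian of two functions of a complex variable. -/
noncomputable def complexWronskian (f g : ℂ → ℂ) (z : ℂ) : ℂ := f z * deriv g z - g z * deriv f z

/-- **Abel's identity** for the Gauss equation. -/
theorem IsGaussSolution.exists_wronskian_eq {a b c : ℂ} {U : Set ℂ} {f g : ℂ → ℂ} (hU : IsOpen U)
    (hU' : IsPreconnected U) (h0 : ∀ z ∈ U, z ∈ Complex.slitPlane)
    (h1 : ∀ z ∈ U, 1 - z ∈ Complex.slitPlane) (hf : IsGaussSolution a b c U f)
    (hg : IsGaussSolution a b c U g) :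
    ∃ k : ℂ, ∀ z ∈ U, z ^ c * (1 - z) ^ (a + b - c + 1) * complexWronskian f g z = k := by
  -- The weight is the integrating factor: its logarithmic derivative is `(c - (a + b + 1) z) / (z
  -- (1 - z))`.
  have hder : ∀ z ∈ U,
      HasDerivAt (fun z => z ^ c * (1 - z) ^ (a + b - c + 1) * complexWronskian f g z) 0 z := by
    intro z hz
    have hw : HasDerivAt (complexWronskian f g) _ z :=
      ((hf.hasDerivAt hU hz).mul (hg.hasDerivAt_deriv hU hz)).sub
        ((hg.hasDerivAt hU hz).mul (hf.hasDerivAt_deriv hU hz))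
    have hp := (((hasDerivAt_id z).cpow_const (c := c) (h0 z hz)).mul
      (hasDerivAt_one_sub_cpow (a + b - c + 1) (h1 z hz))).mul hw
    convert! hp using 1
    have hz0 : z ≠ 0 := Complex.slitPlane_ne_zero (h0 z hz)
    have hz1 : 1 - z ≠ 0 := Complex.slitPlane_ne_zero (h1 z hz)
    simp only [Complex.cpow_sub _ (1 : ℂ) hz1, Complex.cpow_sub _ (1 : ℂ) hz0, Complex.cpow_one,
      complexWronskian, id, Pi.mul_apply]
    generalize (1 - z) ^ (a + b - c + 1) = P
    generalize z ^ c = Q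
    field_simp
    linear_combination Q * P * g z * hf.equation z hz - Q * P * f z * hg.equation z hz
  exact hU.exists_is_const_of_deriv_eq_zero hU'
    (fun z hz => (hder z hz).differentiableAt.differentiableWithinAt) fun z hz => (hder z hz).deriv

/-- Three solutions of the Gauss equation, two of which are independent, are linearly dependent. -/
theorem IsGaussSolution.exists_eq_add {a b c : ℂ} {U : Set ℂ} {f g h : ℂ → ℂ} (hU : IsOpen U)
    (hU' : IsPreconnected U) (h0 : ∀ z ∈ U, z ∈ Complex.slitPlane)
    (h1 : ∀ z ∈ U, 1 - z ∈ Complex.slitPlane) (hf : IsGaussSolution a b c U f)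
    (hg : IsGaussSolution a b c U g) (hh : IsGaussSolution a b c U h)
    {k : ℂ} (hk : k ≠ 0)
    (hgh : ∀ z ∈ U, z ^ c * (1 - z) ^ (a + b - c + 1) * complexWronskian g h z = k) :
    ∃ A B : ℂ, ∀ z ∈ U, f z = A * g z + B * h z := by
  obtain ⟨p, hp⟩ := exists_wronskian_eq hU hU' h0 h1 hf hh
  obtain ⟨q, hq⟩ := exists_wronskian_eq hU hU' h0 h1 hg hf
  -- Cramer's rule: `W(g,h) f = W(f,h) g + W(g,f) h`.
  refine ⟨p / k, q / k, fun z hz => ?_⟩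
  field_simp
  rw [← hgh z hz, ← hp z hz, ← hq z hz]
  simp only [complexWronskian]
  ring

/-! ### Local solutions at `1` and their Wronskian -/

/-- The common domain of the local solutions at `0` and at `1`. -/
def lens : Set ℂ := ball 0 1 ∩ ball 1 1

theorem isOpen_lens : IsOpen lens := isOpen_ball.inter isOpen_ball

theorem isPreconnected_lens : IsPreconnected lens :=
  ((convex_ball 0 1).inter (convex_ball 1 1)).isPreconnected

theorem mem_lens {z : ℂ} : z ∈ lens ↔ ‖z‖ < 1 ∧ ‖1 - z‖ < 1 := by
  simp [lens, dist_eq_norm, norm_sub_rev 1 z]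

theorem ofReal_mem_lens {x : ℝ} (h0 : 0 < x) (h1 : x < 1) : (x : ℂ) ∈ lens := by
  rw [mem_lens, ← Complex.ofReal_one, ← Complex.ofReal_sub, Complex.norm_real, Complex.norm_real,
    Real.norm_of_nonneg h0.le, Real.norm_of_nonneg (by linarith)]
  constructor <;> linarith

theorem eventually_mem_lens : ∀ᶠ x : ℝ in 𝓝[<] 1, (x : ℂ) ∈ lens := by
  filter_upwards [Ioo_mem_nhdsLT (zero_lt_one' ℝ)] with x hx using ofReal_mem_lens hx.1 hx.2

theorem mem_slitPlane_of_mem_lens {z : ℂ} (hz : z ∈ lens) : z ∈ Complex.slitPlane := by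
  simpa using one_sub_mem_slitPlane (mem_lens.1 hz).2

theorem one_sub_mem_slitPlane_of_mem_lens {z : ℂ} (hz : z ∈ lens) :
    1 - z ∈ Complex.slitPlane :=
  one_sub_mem_slitPlane (mem_lens.1 hz).1

/-- The local solution at `1` with exponent `0`. -/
noncomputable def slow (a b c z : ℂ) : ℂ := ₂F₁ a b (a + b - c + 1) (1 - z)

/-- The local solution at `1` with exponent `c - a - b`. -/
noncomputable def fast (a b c z : ℂ) : ℂ :=
  (1 - z) ^ (c - a - b) * ₂F₁ (c - a) (c - b) (c - a - b + 1) (1 - z)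

section Connection

variable {a b c : ℂ}

theorem slow_param_ne (hcab : ∀ n : ℤ, c - a - b ≠ n) (n : ℕ) : a + b - c + 1 ≠ -(n : ℂ) :=
  fun h => hcab (n + 1) (by push_cast; linear_combination -h)

theorem fast_param_ne (hcab : ∀ n : ℤ, c - a - b ≠ n) (n : ℕ) : c - a - b + 1 ≠ -(n : ℂ) :=
  fun h => hcab (-n - 1) (by push_cast; linear_combination h)

theorem fast_exponent_ne (hcab : ∀ n : ℤ, c - a - b ≠ n) (n : ℕ) : c - a - b ≠ -(n : ℂ) :=
  fun h => hcab (-n) (by push_cast; linear_combination h)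

theorem isGaussSolution_slow (hcab : ∀ n : ℤ, c - a - b ≠ n) :
    IsGaussSolution a b c lens (slow a b c) := by
  have h := (isGaussSolution_hypergeometric a b (slow_param_ne hcab)).reflect (V := lens)
    isOpen_ball fun z hz => by simpa using (mem_lens.1 hz).2
  rwa [show a + b + 1 - (a + b - c + 1) = c by ring] at h

theorem isGaussSolution_fast (hcab : ∀ n : ℤ, c - a - b ≠ n) :
    IsGaussSolution a b c lens (fast a b c) := by
  have h := (isGaussSolution_hypergeometric (c - a) (c - b) (fast_param_ne hcab)).reflect
    (V := lens) isOpen_ball fun z hz => by simpa using (mem_lens.1 hz).2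
  rw [show c - a + (c - b) + 1 - (c - a - b + 1) = c by ring] at h
  exact h.one_sub_cpow_mul isOpen_lens fun z hz => one_sub_mem_slitPlane_of_mem_lens hz

theorem deriv_slow (hcab : ∀ n : ℤ, c - a - b ≠ n) {z : ℂ} (hz : z ∈ lens) :
    deriv (slow a b c) z = -(a * b / (a + b - c + 1)) * slow (a + 1) (b + 1) (c + 1) z := by
  have h : deriv (slow a b c) z = -deriv (₂F₁ a b (a + b - c + 1)) (1 - z) :=
    deriv_comp_const_sub (₂F₁ a b (a + b - c + 1)) 1 z
  rw [h, deriv_hypergeometric a b (slow_param_ne hcab) (mem_lens.1 hz).2, slow,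
    show a + 1 + (b + 1) - (c + 1) + 1 = a + b - c + 1 + 1 by ring, neg_mul]

/-- With `s = c - a - b`, the product rule leaves `-(1 - z) ^ (s - 1)` times `s F + (1 - z) F'`,
where `F` has lower parameter `s + 1`; the lowering relation collapses this bracket. -/
theorem deriv_fast (hcab : ∀ n : ℤ, c - a - b ≠ n) {z : ℂ} (hz : z ∈ lens) :
    deriv (fast a b c) z = -(c - a - b) * fast (a + 1) (b + 1) (c + 1) z := by
  have hz1 := one_sub_mem_slitPlane_of_mem_lens hz
  have hd : HasDerivAt (fun z => ₂F₁ (c - a) (c - b) (c - a - b + 1) (1 - z))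
      (-deriv (₂F₁ (c - a) (c - b) (c - a - b + 1)) (1 - z)) z := by
    have h := ((isGaussSolution_hypergeometric (c - a) (c - b) (fast_param_ne hcab)).hasDerivAt
      isOpen_ball (z := 1 - z) (by simpa using (mem_lens.1 hz).2)).comp_const_sub 1 z
    exact h
  have h : deriv (fast a b c) z = _ :=
    deriv_one_sub_cpow_mul (c - a - b) hz1 hd.differentiableAt
  have hlow := hypergeometric_lowering (c - a) (c - b) (fast_exponent_ne hcab) (mem_lens.1 hz).2
  rw [h, hd.deriv, fast, show c + 1 - (a + 1) - (b + 1) = c - a - b - 1 by ring,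
    show c - a - b - 1 + 1 = c - a - b by ring, add_sub_add_right_eq_sub,
    add_sub_add_right_eq_sub, Complex.cpow_sub _ (1 : ℂ) (Complex.slitPlane_ne_zero hz1),
    Complex.cpow_one]
  have := Complex.slitPlane_ne_zero hz1
  field_simp
  linear_combination (-(1 - z) ^ (c - a - b)) * hlow

theorem tendsto_hypergeometric_one_sub (a b : ℂ) (hc : ∀ n : ℕ, c ≠ -(n : ℂ)) :
    Tendsto (fun x : ℝ => ₂F₁ a b c (1 - (x : ℂ))) (𝓝[<] 1) (𝓝 1) := by
  have h1 : ContinuousAt (₂F₁ a b c : ℂ → ℂ) 0 :=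
    ((hasPowerSeries_hypergeometric a b hc).differentiableOn.differentiableAt
      (ball_mem_nhds 0 one_pos)).continuousAt
  have h2 : Tendsto (fun x : ℝ => 1 - (x : ℂ)) (𝓝[<] 1) (𝓝 0) := by
    have : ContinuousAt (fun x : ℝ => 1 - (x : ℂ)) 1 := by fun_prop
    simpa using this.tendsto.mono_left nhdsWithin_le_nhds
  simpa [Function.comp_def] using h1.tendsto.comp h2

theorem wronskian_slow_fast (hcab : ∀ n : ℤ, c - a - b ≠ n) :
    ∀ z ∈ lens, z ^ c * (1 - z) ^ (a + b - c + 1) *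
      complexWronskian (slow a b c) (fast a b c) z = -(c - a - b) := by
  obtain ⟨k, hk⟩ := IsGaussSolution.exists_wronskian_eq isOpen_lens isPreconnected_lens
    (fun z hz => mem_slitPlane_of_mem_lens hz) (fun z hz => one_sub_mem_slitPlane_of_mem_lens hz)
    (isGaussSolution_slow hcab) (isGaussSolution_fast hcab)
  suffices k = -(c - a - b) from this ▸ hk
  have hcab' : ∀ n : ℤ, c + 1 - (a + 1) - (b + 1) ≠ n := fun n h =>
    hcab (n + 1) (by push_cast; linear_combination h)
  have hx : Tendsto (fun x : ℝ => (x : ℂ)) (𝓝[<] 1) (𝓝 1) := by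
    simpa using (Complex.continuous_ofReal.tendsto 1).mono_left nhdsWithin_le_nhds
  have hpow : Tendsto (fun x : ℝ => (x : ℂ) ^ c) (𝓝[<] 1) (𝓝 1) := by
    have h := (continuousAt_id.cpow (continuousAt_const (y := c))
      Complex.one_mem_slitPlane).tendsto.comp hx
    simpa [Function.comp_def] using h
  -- The powers of `1 - x` in the weighted Wronskian combine to `1` in the first term and to `1 - x`
  -- in the second, so the limit at `1` exists whatever the sign of `Re (c - a - b)`.
  have hlim : Tendsto (fun x : ℝ => (x : ℂ) ^ c *
      (₂F₁ a b (a + b - c + 1) (1 - (x : ℂ)) *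
        (-(c - a - b) * ₂F₁ (c - a) (c - b) (c - a - b) (1 - (x : ℂ))) +
        (1 - (x : ℂ)) * ₂F₁ (c - a) (c - b) (c - a - b + 1) (1 - (x : ℂ)) *
          (a * b / (a + b - c + 1) *
            ₂F₁ (a + 1) (b + 1) (a + 1 + (b + 1) - (c + 1) + 1) (1 - (x : ℂ)))))
      (𝓝[<] 1) (𝓝 (1 * (1 * (-(c - a - b) * 1) +
        (1 - 1) * 1 * (a * b / (a + b - c + 1) * 1)))) :=
    hpow.mul (((tendsto_hypergeometric_one_sub _ _ (slow_param_ne hcab)).mul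
      ((tendsto_hypergeometric_one_sub _ _ (fast_exponent_ne hcab)).const_mul _)).add
      (((tendsto_const_nhds.sub hx).mul
        (tendsto_hypergeometric_one_sub _ _ (fast_param_ne hcab))).mul
      ((tendsto_hypergeometric_one_sub _ _ (slow_param_ne hcab')).const_mul _)))
  rw [show 1 * (1 * (-(c - a - b) * 1) + (1 - 1) * 1 * (a * b / (a + b - c + 1) * 1)) =
    -(c - a - b) by ring] at hlim
  refine tendsto_nhds_unique (tendsto_const_nhds.congr' ?_) hlim
  filter_upwards [eventually_mem_lens] with x hxl
  rw [← hk x hxl, complexWronskian, deriv_slow hcab hxl, deriv_fast hcab hxl]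
  have hx1 := Complex.slitPlane_ne_zero (one_sub_mem_slitPlane_of_mem_lens hxl)
  have e1 : (1 - (x : ℂ)) ^ (a + b - c + 1) * (1 - (x : ℂ)) ^ (c - a - b) = 1 - x := by
    rw [← Complex.cpow_add _ _ hx1, show a + b - c + 1 + (c - a - b) = 1 by ring, Complex.cpow_one]
  have e2 : (1 - (x : ℂ)) ^ (a + b - c + 1) * (1 - (x : ℂ)) ^ (c - a - b - 1) = 1 := by
    rw [← Complex.cpow_add _ _ hx1, show a + b - c + 1 + (c - a - b - 1) = 0 by ring,
      Complex.cpow_zero]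
  simp only [slow, fast, show c + 1 - (a + 1) - (b + 1) = c - a - b - 1 by ring,
    show c - a - b - 1 + 1 = c - a - b by ring]
  simp only [add_sub_add_right_eq_sub]
  generalize (₂F₁ a b (a + b - c + 1) (1 - (x : ℂ)) : ℂ) = F1
  generalize (₂F₁ (c - a) (c - b) (c - a - b + 1) (1 - (x : ℂ)) : ℂ) = F2
  generalize (₂F₁ (c - a) (c - b) (c - a - b) (1 - (x : ℂ)) : ℂ) = F3
  generalize (₂F₁ (a + 1) (b + 1) (a + 1 + (b + 1) - (c + 1) + 1) (1 - (x : ℂ)) : ℂ) = F4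
  generalize a * b / (a + b - c + 1) = K
  linear_combination (x : ℂ) ^ c * (F2 * K * F4) * e1 - (x : ℂ) ^ c * (F1 * (c - a - b) * F3) * e2

theorem exists_connection (hc : ∀ n : ℕ, c ≠ -(n : ℂ)) (hcab : ∀ n : ℤ, c - a - b ≠ n) :
    ∃ A B : ℂ, ∀ z ∈ lens, ₂F₁ a b c z = A * slow a b c z + B * fast a b c z :=
  IsGaussSolution.exists_eq_add isOpen_lens isPreconnected_lens
    (fun z hz => mem_slitPlane_of_mem_lens hz) (fun z hz => one_sub_mem_slitPlane_of_mem_lens hz)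
    ((isGaussSolution_hypergeometric a b hc).mono Set.inter_subset_left)
    (isGaussSolution_slow hcab) (isGaussSolution_fast hcab)
    (neg_ne_zero.2 (by simpa using hcab 0)) (wronskian_slow_fast hcab)

end Connection

/-! ### Asymptotics of the coefficients and of the series at `1` -/

theorem ascPochhammer_eval_eq_prod (a : ℂ) (n : ℕ) :
    (ascPochhammer ℂ n).eval a = ∏ j ∈ Finset.range n, (a + j) := by
  induction n with
  | zero => simp
  | succ n ih => rw [ascPochhammer_succ_eval, ih, Finset.prod_range_succ]

/-- The reciprocal form of Gauss's limit, valid also at the poles of the Gamma function. -/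
theorem tendsto_ascPochhammer_div (a : ℂ) :
    Tendsto (fun n : ℕ => (ascPochhammer ℂ (n + 1)).eval a / ((n : ℂ) ^ a * n.factorial)) atTop
      (𝓝 (Complex.Gamma a)⁻¹) := by
  have heq : ∀ n : ℕ, (ascPochhammer ℂ (n + 1)).eval a / ((n : ℂ) ^ a * n.factorial) =
      (Complex.GammaSeq a n)⁻¹ := fun n => by
    rw [Complex.GammaSeq, inv_div, ascPochhammer_eval_eq_prod]
  -- At a pole `a = -m` the Pochhammer values vanish from `n = m` on, matching `1/Γ = 0`.
  by_cases ha : Complex.Gamma a = 0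
  · obtain ⟨m, hm⟩ := (Complex.Gamma_eq_zero_iff a).1 ha
    rw [ha, inv_zero]
    refine tendsto_const_nhds.congr' ?_
    filter_upwards [eventually_ge_atTop m] with n hn
    rw [(ascPochhammer_eval_eq_zero_iff _ _).2 ⟨m, by omega, by rw [hm]; ring⟩, zero_div]
  · simp only [heq]
    exact (Complex.GammaSeq_tendsto_Gamma a).inv₀ ha

/-- The balance `a + b = c + s` cancels the powers of `n` in the four Gauss limits. -/
theorem tendsto_ascPochhammer_ratio {a b c s : ℂ} (h : a + b = c + s)
    (hc : ∀ n : ℕ, c ≠ -(n : ℂ)) (hs : ∀ n : ℕ, s ≠ -(n : ℂ)) :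
    Tendsto (fun n : ℕ => (ascPochhammer ℂ n).eval a * (ascPochhammer ℂ n).eval b /
        ((ascPochhammer ℂ n).eval c * (ascPochhammer ℂ n).eval s)) atTop
      (𝓝 (Complex.Gamma c * Complex.Gamma s / (Complex.Gamma a * Complex.Gamma b))) := by
  rw [← tendsto_add_atTop_iff_nat 1]
  have hl := ((tendsto_ascPochhammer_div a).mul (tendsto_ascPochhammer_div b)).div
    ((tendsto_ascPochhammer_div c).mul (tendsto_ascPochhammer_div s))
    (mul_ne_zero (inv_ne_zero (Complex.Gamma_ne_zero hc)) (inv_ne_zero (Complex.Gamma_ne_zero hs)))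
  rw [show (Complex.Gamma a)⁻¹ * (Complex.Gamma b)⁻¹ / ((Complex.Gamma c)⁻¹ * (Complex.Gamma s)⁻¹) =
    Complex.Gamma c * Complex.Gamma s / (Complex.Gamma a * Complex.Gamma b) by
      rw [← mul_inv, ← mul_inv, div_inv_eq_mul, div_eq_mul_inv, mul_comm]] at hl
  refine hl.congr' ?_
  filter_upwards [eventually_ne_atTop 0] with n hn
  have hn' : (n : ℂ) ≠ 0 := by exact_mod_cast hn
  have hf : (n.factorial : ℂ) ≠ 0 := by exact_mod_cast n.factorial_ne_zero
  have hp : (n : ℂ) ^ a * (n : ℂ) ^ b = (n : ℂ) ^ c * (n : ℂ) ^ s := by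
    rw [← Complex.cpow_add _ _ hn', ← Complex.cpow_add _ _ hn', h]
  have hpa : (n : ℂ) ^ c ≠ 0 := by simp [Complex.cpow_eq_zero_iff, hn']
  have hpb : (n : ℂ) ^ s ≠ 0 := by simp [Complex.cpow_eq_zero_iff, hn']
  simp only [Pi.div_apply]
  rw [div_mul_div_comm, div_mul_div_comm, mul_mul_mul_comm ((n : ℂ) ^ a), hp,
    mul_mul_mul_comm ((n : ℂ) ^ c)]
  exact div_div_div_cancel_right₀ (by positivity) _ _

/-- The binomial coefficients `(s)ₙ / n!`. -/
noncomputable def binomialCoeff (s : ℂ) (n : ℕ) : ℂ := (ascPochhammer ℂ n).eval s / n.factorial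

/-- This is Euler's transformation with `b = c = 1`: the transformed series has upper parameter `0`
and is constantly `1`. -/
theorem hasPowerSeries_binomial (s : ℂ) :
    HasPowerSeries (binomialCoeff s) (fun x => (1 - x) ^ (-s)) := by
  have h1 : ∀ n : ℕ, (1 : ℂ) ≠ -(n : ℂ) := fun n h => by
    have : ((1 + n : ℕ) : ℂ) = 0 := by push_cast; linear_combination h
    norm_cast at this
    omega
  refine ((hasPowerSeries_hypergeometric s 1 h1).congr_coeff fun n => ?_).congr_fun fun x hx => ?_
  · have : (ascPochhammer ℂ n).eval 1 ≠ 0 := ascPochhammer_eval_ne_zero h1 n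
    simp only [coeff, ordinaryHypergeometricCoefficient, binomialCoeff]
    field_simp
  · have h0 : ₂F₁ (1 - s) (1 - 1) 1 x = (1 : ℂ) := by
      refine ((hasPowerSeries_hypergeometric (1 - s) (1 - 1) h1 x hx).unique ?_)
      convert! hasSum_ite_eq (0 : ℕ) (1 : ℂ) using 2 with n
      cases n <;> simp [coeff, ordinaryHypergeometricCoefficient, ascPochhammer_eval_succ_left]
    rw [← euler_transformation s 1 h1 hx, h0, show 1 - s - 1 = -s by ring, mul_one]

theorem norm_binomialCoeff_ofReal {r : ℝ} (hr : 0 < r) (n : ℕ) :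
    ((‖binomialCoeff r n‖ : ℝ) : ℂ) = binomialCoeff r n := by
  have h : binomialCoeff r n = (((ascPochhammer ℝ n).eval r / n.factorial : ℝ) : ℂ) := by
    rw [binomialCoeff]
    push_cast
    rw [← ascPochhammer_map Complex.ofRealHom, Polynomial.eval_map]
    exact congrArg (· / (n.factorial : ℂ)) (Polynomial.eval₂_at_apply Complex.ofRealHom r)
  rw [h, Complex.norm_real, Real.norm_of_nonneg]
  exact div_nonneg (ascPochhammer_pos n r hr).le (Nat.cast_nonneg _)

theorem hasSum_norm_binomialCoeff {r x : ℝ} (hr : 0 < r) (h0 : 0 < x) (h1 : x < 1) :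
    HasSum (fun n => ‖binomialCoeff r n‖ * x ^ n) ((1 - x) ^ (-r)) := by
  have h := hasPowerSeries_binomial r x (by simpa [abs_of_pos h0] using h1)
  rw [← Complex.hasSum_ofReal]
  convert! h using 2 with n
  · rw [← norm_binomialCoeff_ofReal hr n]; push_cast; simp
  · rw [Complex.ofReal_cpow (by linarith)]; push_cast; rfl

theorem tendsto_one_sub_rpow {r : ℝ} (hr : 0 < r) :
    Tendsto (fun x : ℝ => (1 - x) ^ r) (𝓝[<] 1) (𝓝 0) := by
  have h : ContinuousAt (fun x : ℝ => (1 - x) ^ r) 1 :=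
    (by fun_prop : ContinuousAt (fun x : ℝ => 1 - x) 1).rpow_const (Or.inr hr.le)
  simpa [Real.zero_rpow hr.ne'] using h.tendsto.mono_left nhdsWithin_le_nhds

/-- An Abelian theorem: a power series whose coefficients are negligible against those of
`(1 - x) ^ (-r)` is negligible against that function at `1`. -/
theorem tendsto_rpow_mul_of_isLittleO {r : ℝ} (hr : 0 < r) {u : ℕ → ℂ} {f : ℂ → ℂ}
    (hf : HasPowerSeries u f) (hu : u =o[atTop] binomialCoeff r) :
    Tendsto (fun x : ℝ => (1 - x) ^ r * ‖f x‖) (𝓝[<] 1) (𝓝 0) := by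
  rw [Metric.tendsto_nhds]
  intro ε hε
  -- Beyond `N` the terms are at most `ε / 2` times the positive binomial ones; the finite head is
  -- bounded and is killed by `(1 - x) ^ r`.
  obtain ⟨N, hN⟩ := eventually_atTop.1 (hu.bound (half_pos hε))
  have hM := ((tendsto_one_sub_rpow hr).mul_const (∑ n ∈ Finset.range N, ‖u n‖)).eventually_lt_const
    (u := ε / 2) (by simpa using hε)
  filter_upwards [hM, Ioo_mem_nhdsLT (zero_lt_one' ℝ)] with x hM hx
  have hpos : 0 < (1 - x) ^ r := Real.rpow_pos_of_pos (by linarith [hx.2]) r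
  have hs := (hasSum_norm_binomialCoeff hr hx.1 hx.2).mul_left (ε / 2)
  have hm : HasSum (fun n => if n ∈ Finset.range N then ‖u n‖ else 0)
      (∑ n ∈ Finset.range N, ‖u n‖) := by
    rw [← Finset.sum_congr rfl fun n hn => if_pos hn]
    exact hasSum_sum_of_ne_finset_zero fun n hn => if_neg hn
  have hle : ‖f x‖ ≤ ∑ n ∈ Finset.range N, ‖u n‖ + ε / 2 * (1 - x) ^ (-r) := by
    rw [← (hf x (by simpa [abs_of_pos hx.1] using hx.2)).tsum_eq]
    refine tsum_of_norm_bounded (hm.add hs) fun n => ?_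
    have hxn : ‖(x : ℂ) ^ n‖ = x ^ n := by simp [abs_of_pos hx.1]
    have hxn0 : 0 ≤ x ^ n := pow_nonneg hx.1.le n
    have hxn1 : x ^ n ≤ 1 := pow_le_one₀ hx.1.le hx.2.le
    rw [norm_mul, hxn]
    split_ifs with h
    · have : 0 ≤ ε / 2 * (‖binomialCoeff r n‖ * x ^ n) := by positivity
      nlinarith [norm_nonneg (u n)]
    · rw [zero_add, ← mul_assoc]
      exact mul_le_mul_of_nonneg_right (hN n (by simpa using h)) hxn0
  rw [dist_zero_right, Real.norm_of_nonneg (by positivity)]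
  calc (1 - x) ^ r * ‖f x‖
      ≤ (1 - x) ^ r * (∑ n ∈ Finset.range N, ‖u n‖ + ε / 2 * (1 - x) ^ (-r)) := by gcongr
    _ = (1 - x) ^ r * (∑ n ∈ Finset.range N, ‖u n‖) + ε / 2 := by
        rw [Real.rpow_neg (by linarith [hx.2])]
        field_simp
    _ < ε := by linarith

theorem ne_neg_natCast_of_re_pos {s : ℂ} (hs : 0 < s.re) (n : ℕ) : s ≠ -(n : ℂ) := fun h => by
  rw [h] at hs
  simp only [Complex.neg_re, Complex.natCast_re] at hs
  linarith [n.cast_nonneg (α := ℝ)]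

/-- Gauss's limit applies to both sides, and `‖n ^ s‖ = n ^ Re s`. This supplies the positive
majorant that the Abelian theorem needs. -/
theorem binomialCoeff_isBigO {s : ℂ} (hs : 0 < s.re) :
    binomialCoeff s =O[atTop] binomialCoeff (s.re : ℂ) := by
  have hr : ∀ n : ℕ, ((s.re : ℝ) : ℂ) ≠ -(n : ℂ) := ne_neg_natCast_of_re_pos (by simpa using hs)
  have hl := (tendsto_ascPochhammer_div s).norm.div (tendsto_ascPochhammer_div (s.re : ℂ)).norm
    (norm_ne_zero_iff.2 (inv_ne_zero (Complex.Gamma_ne_zero hr)))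
  refine Asymptotics.isBigO_norm_norm.1 (Asymptotics.isBigO_of_div_tendsto_nhds
    (Eventually.of_forall fun n hn => absurd hn ?_) _ ((tendsto_add_atTop_iff_nat 1).1
    (hl.congr' ?_)))
  · exact norm_ne_zero_iff.2 (div_ne_zero (ascPochhammer_eval_ne_zero hr n)
      (by exact_mod_cast n.factorial_ne_zero))
  · filter_upwards [eventually_gt_atTop 0] with n hn
    have hpow : (n : ℝ) ^ s.re ≠ 0 := (Real.rpow_pos_of_pos (by exact_mod_cast hn) _).ne'
    simp only [Pi.div_apply, binomialCoeff, norm_div, norm_mul,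
      Complex.norm_natCast_cpow_of_pos hn, Complex.ofReal_re, Complex.norm_natCast]
    rw [div_div_div_cancel_right₀ (by positivity), div_div_div_cancel_right₀ (by positivity)]

/-- The hypergeometric coefficients are `K + o(1)` times those of `(1 - x) ^ (-s)`, so the Abelian
theorem applies to the difference `₂F₁ - K (1 - x) ^ (-s)`. -/
theorem tendsto_cpow_mul_hypergeometric {a b c s : ℂ} (h : a + b = c + s)
    (hc : ∀ n : ℕ, c ≠ -(n : ℂ)) (hs : 0 < s.re) :
    Tendsto (fun x : ℝ => (1 - (x : ℂ)) ^ s * ₂F₁ a b c (x : ℂ)) (𝓝[<] 1)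
      (𝓝 (Complex.Gamma c * Complex.Gamma s / (Complex.Gamma a * Complex.Gamma b))) := by
  set K := Complex.Gamma c * Complex.Gamma s / (Complex.Gamma a * Complex.Gamma b)
  have hs' := ne_neg_natCast_of_re_pos hs
  have hser := (hasPowerSeries_hypergeometric a b hc).sub ((hasPowerSeries_binomial s).const_mul K)
  have hu : (fun n => coeff a b c n - K * binomialCoeff s n) =o[atTop] binomialCoeff s.re := by
    refine Asymptotics.IsLittleO.trans_isBigO ?_ (binomialCoeff_isBigO hs)
    have h0 : (fun n => (ascPochhammer ℂ n).eval a * (ascPochhammer ℂ n).eval b /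
        ((ascPochhammer ℂ n).eval c * (ascPochhammer ℂ n).eval s) - K) =o[atTop]
        fun _ => (1 : ℂ) := by
      rw [Asymptotics.isLittleO_one_iff, ← sub_self K]
      exact (tendsto_ascPochhammer_ratio h hc hs').sub_const K
    refine (h0.mul_isBigO (Asymptotics.isBigO_refl (binomialCoeff s) atTop)).congr
      (fun n => ?_) fun n => one_mul _
    have := ascPochhammer_eval_ne_zero hc n
    have := ascPochhammer_eval_ne_zero hs' n
    simp only [coeff, ordinaryHypergeometricCoefficient, binomialCoeff]
    field_simp
  have h1 := tendsto_rpow_mul_of_isLittleO hs hser hu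
  rw [← tendsto_sub_nhds_zero_iff, tendsto_zero_iff_norm_tendsto_zero]
  refine h1.congr' ?_
  filter_upwards [Ioo_mem_nhdsLT (zero_lt_one' ℝ)] with x hx
  have hx1 : (0 : ℝ) < 1 - x := by linarith [hx.2]
  have hx2 : (1 - (x : ℂ)) ≠ 0 := by exact_mod_cast hx1.ne'
  have hn : ‖(1 - (x : ℂ)) ^ s‖ = (1 - x) ^ s.re := by
    rw [← Complex.norm_cpow_eq_rpow_re_of_pos hx1]; push_cast; rfl
  rw [← hn, ← norm_mul, Complex.cpow_neg]
  have hx3 : (1 - (x : ℂ)) ^ s ≠ 0 := by simp [Complex.cpow_eq_zero_iff, hx2]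
  congr 1
  field_simp

/-! ### The connection coefficients -/

section ConnectionCoefficients

variable {a b c : ℂ}

/-- Differentiation keeps the shape of the relation with all three parameters raised. The scalar `x`
absorbs `a * b / c`, which may vanish and so cannot be divided out. -/
theorem deriv_connection (hc : ∀ n : ℕ, c ≠ -(n : ℂ)) (hcab : ∀ n : ℤ, c - a - b ≠ n) {x A B : ℂ}
    (h : ∀ z ∈ lens, x * ₂F₁ a b c z = A * slow a b c z + B * fast a b c z) {z : ℂ}
    (hz : z ∈ lens) :
    x * (a * b / c) * ₂F₁ (a + 1) (b + 1) (c + 1) z =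
      -(A * (a * b / (a + b - c + 1))) * slow (a + 1) (b + 1) (c + 1) z +
        -(B * (c - a - b)) * fast (a + 1) (b + 1) (c + 1) z := by
  have hev : (fun z => x * ₂F₁ a b c z) =ᶠ[𝓝 z] fun z => A * slow a b c z + B * fast a b c z := by
    filter_upwards [isOpen_lens.mem_nhds hz] with w hw using h w hw
  have hd := hev.deriv_eq
  rw [deriv_const_mul_field, deriv_hypergeometric a b hc (mem_lens.1 hz).1,
    deriv_fun_add
      (((isGaussSolution_slow hcab).hasDerivAt isOpen_lens hz).differentiableAt.const_mul A)
      (((isGaussSolution_fast hcab).hasDerivAt isOpen_lens hz).differentiableAt.const_mul B),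
    deriv_const_mul_field, deriv_const_mul_field, deriv_slow hcab hz, deriv_fast hcab hz] at hd
  linear_combination hd

/-- After multiplication by `(1 - y) ^ (a + b - c)` the slow term tends to `0` and the fast term to
`B` as `y → 1`. -/
theorem fast_coefficient_of_re_neg (hc : ∀ n : ℕ, c ≠ -(n : ℂ)) (hcab : ∀ n : ℤ, c - a - b ≠ n)
    (hre : (c - a - b).re < 0) {x A B : ℂ}
    (h : ∀ z ∈ lens, x * ₂F₁ a b c z = A * slow a b c z + B * fast a b c z) :
    B = x * (Complex.Gamma c * Complex.Gamma (a + b - c) /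
      (Complex.Gamma a * Complex.Gamma b)) := by
  have hs : 0 < (a + b - c).re := by
    simp only [Complex.sub_re, Complex.add_re] at hre ⊢
    linarith
  have hl := (tendsto_cpow_mul_hypergeometric (a := a) (b := b) (by ring) hc hs).const_mul x
  have hw : Tendsto (fun y : ℝ => (1 - (y : ℂ)) ^ (a + b - c)) (𝓝[<] 1) (𝓝 0) := by
    rw [tendsto_zero_iff_norm_tendsto_zero]
    refine (tendsto_one_sub_rpow hs).congr' ?_
    filter_upwards [self_mem_nhdsWithin] with y hy
    rw [← Complex.norm_cpow_eq_rpow_re_of_pos (sub_pos.2 hy)]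
    push_cast
    rfl
  have hr := ((hw.mul (tendsto_hypergeometric_one_sub a b (slow_param_ne hcab))).const_mul A).add
    ((tendsto_hypergeometric_one_sub (c - a) (c - b) (fast_param_ne hcab)).const_mul B)
  rw [show A * (0 * 1) + B * 1 = B by ring] at hr
  refine tendsto_nhds_unique (hr.congr' ?_) hl
  filter_upwards [eventually_mem_lens] with y hy
  have e : (1 - (y : ℂ)) ^ (a + b - c) * (1 - (y : ℂ)) ^ (c - a - b) = 1 := by
    rw [← Complex.cpow_add _ _ (Complex.slitPlane_ne_zero (one_sub_mem_slitPlane_of_mem_lens hy)),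
      show a + b - c + (c - a - b) = 0 by ring, Complex.cpow_zero]
  have hy' := h y hy
  simp only [slow, fast] at hy'
  linear_combination (-(1 - (y : ℂ)) ^ (a + b - c)) * hy' -
    B * ₂F₁ (c - a) (c - b) (c - a - b + 1) (1 - (y : ℂ)) * e

theorem fast_coefficient_of_re_lt (N : ℕ) : ∀ {a b c x A B : ℂ}, (∀ n : ℕ, c ≠ -(n : ℂ)) →
    (∀ n : ℤ, c - a - b ≠ n) → (c - a - b).re < N →
    (∀ z ∈ lens, x * ₂F₁ a b c z = A * slow a b c z + B * fast a b c z) →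
    B = x * (Complex.Gamma c * Complex.Gamma (a + b - c) /
      (Complex.Gamma a * Complex.Gamma b)) := by
  induction N with
  | zero => exact fun hc hcab hre h => fast_coefficient_of_re_neg hc hcab (by simpa using hre) h
  | succ N ih =>
    intro a b c x A B hc hcab hre h
    have hD : c - a - b ≠ 0 := by simpa using hcab 0
    have hc0 : c ≠ 0 := by simpa using hc 0
    have hcab' : ∀ n : ℤ, c + 1 - (a + 1) - (b + 1) ≠ n := fun n h =>
      hcab (n + 1) (by push_cast; linear_combination h)
    have hre' : (c + 1 - (a + 1) - (b + 1)).re < N := by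
      push_cast at hre
      simp only [Complex.sub_re, Complex.add_re, Complex.one_re] at hre ⊢
      linarith
    have key := ih (add_one_ne_neg_natCast hc) hcab' hre' fun z hz => deriv_connection hc hcab h hz
    rw [show a + 1 + (b + 1) - (c + 1) = a + b - c + 1 by ring, Complex.Gamma_add_one c hc0,
      Complex.Gamma_add_one (a + b - c) fun h => hD (by linear_combination -h)] at key
    -- The form `1/Γ(a) = a/Γ(a+1)` of the functional equation holds at the poles too, so `a` and
    -- `b` stay unrestricted.
    rw [div_eq_mul_inv, mul_inv, Complex.one_div_Gamma_eq_self_mul_one_div_Gamma_add_one a,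
      Complex.one_div_Gamma_eq_self_mul_one_div_Gamma_add_one b]
    rw [div_eq_mul_inv (c * _ * _), mul_inv] at key
    refine mul_left_cancel₀ hD ?_
    have hcc : a * b / c * c = a * b := div_mul_cancel₀ _ hc0
    linear_combination -key + x * Complex.Gamma c * (a + b - c) * Complex.Gamma (a + b - c) *
      (Complex.Gamma (a + 1))⁻¹ * (Complex.Gamma (b + 1))⁻¹ * (-hcc)

theorem fast_coefficient (hc : ∀ n : ℕ, c ≠ -(n : ℂ)) (hcab : ∀ n : ℤ, c - a - b ≠ n) {A B : ℂ}
    (h : ∀ z ∈ lens, ₂F₁ a b c z = A * slow a b c z + B * fast a b c z) :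
    B = Complex.Gamma c * Complex.Gamma (a + b - c) / (Complex.Gamma a * Complex.Gamma b) := by
  obtain ⟨N, hN⟩ := exists_nat_gt (c - a - b).re
  simpa using fast_coefficient_of_re_lt N hc hcab hN (x := 1) (A := A) (B := B)
    fun z hz => by rw [one_mul, h z hz]

/-- **Gauss's connection formula** between the local solutions at `0` and at `1`. -/
theorem connection_formula (hc : ∀ n : ℕ, c ≠ -(n : ℂ)) (hcab : ∀ n : ℤ, c - a - b ≠ n) {z : ℂ}
    (hz : z ∈ lens) :
    ₂F₁ a b c z =
      Complex.Gamma c * Complex.Gamma (c - a - b) /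
        (Complex.Gamma (c - a) * Complex.Gamma (c - b)) * slow a b c z +
      Complex.Gamma c * Complex.Gamma (a + b - c) /
        (Complex.Gamma a * Complex.Gamma b) * fast a b c z := by
  obtain ⟨A, B, h⟩ := exists_connection hc hcab
  have hcab' : ∀ n : ℤ, c - (c - a) - (c - b) ≠ n := fun n h =>
    hcab (-n) (by push_cast; linear_combination -h)
  -- Under `(a, b) ↦ (c - a, c - b)` Euler's factor turns slow into fast and conversely, so `A`
  -- becomes a fast coefficient.
  have h' : ∀ w ∈ lens, ₂F₁ (c - a) (c - b) c w =
      B * slow (c - a) (c - b) c w + A * fast (c - a) (c - b) c w := fun w hw => by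
    have hw1 := Complex.slitPlane_ne_zero (one_sub_mem_slitPlane_of_mem_lens hw)
    have e : (1 - w) ^ (c - (c - a) - (c - b)) * (1 - w) ^ (c - a - b) = 1 := by
      rw [← Complex.cpow_add _ _ hw1, show c - (c - a) - (c - b) + (c - a - b) = 0 by ring,
        Complex.cpow_zero]
    rw [← euler_transformation (c - a) (c - b) hc (mem_lens.1 hw).1, sub_sub_cancel,
      sub_sub_cancel, h w hw]
    simp only [slow, fast, sub_sub_cancel]
    rw [show c - a + (c - b) - c + 1 = c - a - b + 1 by ring,
      show a - (c - b) + 1 = a + b - c + 1 by ring]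
    rw [sub_sub_cancel] at e
    linear_combination B * ₂F₁ (c - a) (c - b) (c - a - b + 1) (1 - w) * e
  have hA := fast_coefficient hc hcab' h'
  rw [show c - a + (c - b) - c = c - a - b by ring] at hA
  rw [← hA, ← fast_coefficient hc hcab h, h z hz]

end ConnectionCoefficients

end GaussHypergeometric

/-! ### The radial functions and their Wronskians -/

namespace HypergeometricSpectral

open Filter Topology GaussHypergeometric

variable {p : Params} {ω : ℂ}

theorem Rfast_eq {x : ℝ} (hx : x ∈ Set.Ioo (0 : ℝ) 1) : Rfast p ω x =
    (x : ℂ) ^ p.ρ₀ ω * (1 - (x : ℂ)) ^ p.ρ₁ ω * fast (p.a ω) (p.b ω) (p.c ω) x := by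
  have h1 : 1 - (x : ℂ) ≠ 0 :=
    Complex.slitPlane_ne_zero (one_sub_mem_slitPlane_of_mem_lens (ofReal_mem_lens hx.1 hx.2))
  rw [Rfast, fast, show p.ρ₁ ω + p.c ω - p.a ω - p.b ω = p.ρ₁ ω + (p.c ω - p.a ω - p.b ω) by ring,
    Complex.cpow_add _ _ h1]
  ring

theorem Rin_eq (hc : ∀ n : ℕ, p.c ω ≠ -(n : ℂ)) (hcab : ∀ n : ℤ, p.c ω - p.a ω - p.b ω ≠ n)
    {x : ℝ} (hx : x ∈ Set.Ioo (0 : ℝ) 1) :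
    Rin p ω x = Cslow p ω * Rslow p ω x + Cfast p ω * Rfast p ω x := by
  rw [Rfast_eq hx, Rin, connection_formula hc hcab (ofReal_mem_lens hx.1 hx.2), Rslow, Cslow,
    Cfast, slow]
  ring

theorem differentiableAt_prefactor_mul {f : ℂ → ℂ} {x : ℝ} (hx : x ∈ Set.Ioo (0 : ℝ) 1)
    (r s : ℂ) (hf : DifferentiableAt ℂ f x) :
    DifferentiableAt ℝ (fun x : ℝ => (x : ℂ) ^ r * (1 - (x : ℂ)) ^ s * f x) x := by
  have hl := ofReal_mem_lens hx.1 hx.2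
  have h0 : DifferentiableAt ℂ (fun z : ℂ => z ^ r) x :=
    differentiableAt_id.cpow_const (mem_slitPlane_of_mem_lens hl)
  have h1 := (hasDerivAt_one_sub_cpow s (one_sub_mem_slitPlane_of_mem_lens hl)).differentiableAt
  exact ((h0.mul h1).mul hf).hasDerivAt.comp_ofReal.differentiableAt

end HypergeometricSpectral

open HypergeometricSpectral GaussHypergeometric in
theorem proposition2 (p : HypergeometricSpectral.Params) (α β ω : ℂ)
    (hc : ∀ n : ℕ, p.c ω ≠ -(n : ℂ))
    (hcab : ∀ n : ℤ, p.c ω - p.a ω - p.b ω ≠ (n : ℂ))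
    (z : ℝ) (hz : z ∈ Set.Ioo (0 : ℝ) 1) :
    DifferentiableAt ℝ (HypergeometricSpectral.Rin p ω) z ∧
    DifferentiableAt ℝ (HypergeometricSpectral.Rslow p ω) z ∧
    DifferentiableAt ℝ (HypergeometricSpectral.Rfast p ω) z ∧
    HypergeometricSpectral.wronskian
        (HypergeometricSpectral.Rin p ω) (HypergeometricSpectral.RB p α β ω) z =
      -HypergeometricSpectral.quantizationF p α β ω *
        HypergeometricSpectral.wronskian
          (HypergeometricSpectral.Rslow p ω) (HypergeometricSpectral.Rfast p ω) z := by
  have hl := ofReal_mem_lens hz.1 hz.2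
  have hnhds : Set.Ioo (0 : ℝ) 1 ∈ nhds z := isOpen_Ioo.mem_nhds hz
  have hin : DifferentiableAt ℝ (Rin p ω) z := differentiableAt_prefactor_mul hz _ _
    ((isGaussSolution_hypergeometric _ _ hc).hasDerivAt Metric.isOpen_ball hl.1).differentiableAt
  have hslow : DifferentiableAt ℝ (Rslow p ω) z := differentiableAt_prefactor_mul hz _ _
    ((isGaussSolution_slow hcab).hasDerivAt isOpen_lens hl).differentiableAt
  have hfast : DifferentiableAt ℝ (Rfast p ω) z := by
    refine (differentiableAt_prefactor_mul hz (p.ρ₀ ω) (p.ρ₁ ω)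
      ((isGaussSolution_fast hcab).hasDerivAt isOpen_lens hl).differentiableAt).congr_of_eventuallyEq
      ?_
    filter_upwards [hnhds] with x hx using Rfast_eq hx
  refine ⟨hin, hslow, hfast, ?_⟩
  have hd : deriv (Rin p ω) z =
      Cslow p ω * deriv (Rslow p ω) z + Cfast p ω * deriv (Rfast p ω) z := by
    have hev : Rin p ω =ᶠ[nhds z] fun x => Cslow p ω * Rslow p ω x + Cfast p ω * Rfast p ω x := by
      filter_upwards [hnhds] with x hx using Rin_eq hc hcab hx
    rw [hev.deriv_eq, deriv_fun_add (hslow.const_mul _) (hfast.const_mul _),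
      deriv_const_mul_field, deriv_const_mul_field]
  have hB : deriv (RB p α β ω) z = β * deriv (Rslow p ω) z - α * deriv (Rfast p ω) z := by
    have h : RB p α β ω = fun x => β * Rslow p ω x - α * Rfast p ω x := rfl
    rw [h, deriv_fun_sub (hslow.const_mul _) (hfast.const_mul _), deriv_const_mul_field,
      deriv_const_mul_field]
  -- What remains is the determinant of the change of basis, `Cslow * (-α) - Cfast * β`.
  rw [wronskian, wronskian, hd, hB, Rin_eq hc hcab hz, RB, quantizationF]
  ring
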